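/- Let $n\ge 1$ and let $A\in M_n(\mathbb Z)$ satisfy $\det A\neq 0$, with characteristic polynomial $h_A\in\mathbb Z[x]$ irreducible. For a prime $p$ let $t_p$ be the multiplicity of $0$ as a root of $h_A$ modulo $p$. Assume that there is a prime $p\mid\det A$ with $h_A\not\equiv x^n\pmod p$, and that there is a prime $p$ with $\gcd(n,t_p)=1$. Let $$\mathbb S_A=\Big\{(z_j)_{j\ge 1}\in\prod_{j\ge 1}\mathbb T^n \;\Big|\; A z_{j+1}=z_j \text{ for all } j\Big\},\qquad \mathbb T^n=\mathbb R^n/\mathbb Z^n,$$ be the toroidal solenoid of $A$, a topological group with the topology induced from the product topology. Let $\lambda\in\overline{\mathbb Q}$ be an eigenvalue of $A$, let $\mathbf u=(u_1,\dots,u_n)^t\in\overline{\mathbb Q}^n$ be an eigenvector of $A$ corresponding to $\lambda$, and let $Y$ be the $\mathbb Z[\lambda^{\pm1}]$-submodule of $\overline{\mathbb Q}$ generated by $u_1,\dots,u_n$, with the discrete topology. Let $\widehat Y=\operatorname{Hom}_{cont}(Y,\mathbb R/\mathbb Z)$ be its Pontryagin dual, with the compact-open topology. Let $K=\mathbb Q(\lambda)$,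 let $\mathcal O_K$ be its ring of integers, $\mathcal O_{K,\lambda}=\mathcal O_K[\lambda^{-1}]$ and $\mathcal R=\mathbb Z[1/\det A]$. (1) There is an isomorphism of topological groups $\Phi:\mathbb S_A\to\widehat Y$ under which each continuous group endomorphism $\alpha$ of $\mathbb S_A$ is dual to multiplication on $Y$ by an element of $\mathcal O_{K,\lambda}$: there is $x\in\mathcal O_{K,\lambda}$ such that $\hat\alpha(y)=xy$ defines an endomorphism $\hat\alpha$ of $Y$ and $\Phi(\alpha(s))=\Phi(s)\circ\hat\alpha$ for all $s\in\mathbb S_A$. (2) If $u_1,\dots,u_n\in\mathcal O_K$, then $Y\subseteq\mathcal O_{K,\lambda}$ and $$\operatorname{Span}_{\mathbb Z}(u_1,\dots,u_n)\subseteq Y\subseteq \operatorname{Span}_{\mathcal R}(u_1,\dots,u_n).$$ -/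

import Mathlib

open scoped Matrix NumberField IntermediateField

/-- The field of algebraic numbers. -/
abbrev QBar : Type := AlgebraicClosure ℚ

/-- The set of primes `p` dividing `det A` such that the characteristic polynomial of `A` is not
congruent to `x ^ n` modulo `p`. -/
def primesPrime {n : ℕ} (A : Matrix (Fin n) (Fin n) ℤ) : Set ℕ :=
  {p | p.Prime ∧ (p : ℤ) ∣ A.det ∧
    A.charpoly.map (Int.castRingHom (ZMod p)) ≠ Polynomial.X ^ n}

/-- `t_p`: the multiplicity of zero as a root of the characteristic polynomial of `A` modulo `p`. -/
noncomputable def zeroMultiplicity {n : ℕ} (A : Matrix (Fin n) (Fin n) ℤ) (p : ℕ) : ℕ :=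
  (A.charpoly.map (Int.castRingHom (ZMod p))).rootMultiplicity 0

/-- The endomorphism of the torus `𝕋ⁿ = (ℝ/ℤ)ⁿ` induced by an integer matrix. -/
noncomputable def torusEnd {n : ℕ} (A : Matrix (Fin n) (Fin n) ℤ) :
    (Fin n → UnitAddCircle) →+ (Fin n → UnitAddCircle) where
  toFun z := fun i => ∑ j, A i j • z j
  map_zero' := by ext i; simp
  map_add' z w := by ext i; simp [smul_add, Finset.sum_add_distrib]

/-- `A [x] = [A x]` for `x ∈ ℝⁿ`. -/
theorem torusEnd_coe {n : ℕ} (A : Matrix (Fin n) (Fin n) ℤ) (x : Fin n → ℝ) :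
    torusEnd A (fun j => (x j : UnitAddCircle)) =
      fun i => (((A.map (Int.cast : ℤ → ℝ)) *ᵥ x) i : UnitAddCircle) := by
  funext i
  have h : ∀ f : Fin n → ℝ, ((∑ j, f j : ℝ) : UnitAddCircle) = ∑ j, (f j : UnitAddCircle) :=
    fun f => map_sum (QuotientAddGroup.mk' (AddSubgroup.zmultiples (1 : ℝ))) f Finset.univ
  simp only [torusEnd, AddMonoidHom.coe_mk, ZeroHom.coe_mk, Matrix.mulVec, dotProduct,
    Matrix.map_apply, h]
  refine Finset.sum_congr rfl fun j _ => ?_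
  rw [← zsmul_eq_mul, AddCircle.coe_zsmul]

/-- The toroidal solenoid: the inverse limit of `𝕋ⁿ ← 𝕋ⁿ ← ⋯` along the map induced by `A`, a
topological group with the topology induced from the product topology. -/
noncomputable def solenoid {n : ℕ} (A : Matrix (Fin n) (Fin n) ℤ) :
    AddSubgroup (ℕ → Fin n → UnitAddCircle) where
  carrier := {z | ∀ j, torusEnd A (z (j + 1)) = z j}
  zero_mem' := fun j => by simp
  add_mem' := fun {z w} hz hw j => by
    change torusEnd A (z (j + 1) + w (j + 1)) = z j + w j
    rw [map_add, hz j, hw j]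
  neg_mem' := fun {z} hz j => by
    change torusEnd A (-z (j + 1)) = -z j
    rw [map_neg, hz j]

/-- The `ℤ[λ, λ⁻¹]`-submodule of `ℚ̄` generated by the entries of `u`. -/
noncomputable def entryModule {n : ℕ} (lam : QBar) (u : Fin n → QBar) :
    Submodule (Algebra.adjoin ℤ {lam, lam⁻¹}) QBar :=
  Submodule.span (Algebra.adjoin ℤ {lam, lam⁻¹}) (Set.range u)

/-- The module generated by the entries of `u` carries the discrete topology. -/
instance entryModuleTopology {n : ℕ} (lam : QBar) (u : Fin n → QBar) :
    TopologicalSpace (entryModule lam u) := ⊥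

instance entryModuleDiscrete {n : ℕ} (lam : QBar) (u : Fin n → QBar) :
    DiscreteTopology (entryModule lam u) := ⟨rfl⟩

/-- The Pontryagin dual `Hom_cont(G, ℝ/ℤ)` of an additive topological group, a topological group
with the compact-open topology. -/
abbrev AddDual (G : Type*) [AddCommGroup G] [TopologicalSpace G] : Type _ :=
  G →ₜ+ UnitAddCircle

/-- `𝓞_{K,λ} = 𝓞_K[λ⁻¹]` inside `ℚ̄`, where `K = ℚ(λ)`. -/
noncomputable def ringOKLam (lam : QBar) : Subalgebra (𝓞 ℚ⟮lam⟯) QBar :=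
  Algebra.adjoin (𝓞 ℚ⟮lam⟯) {lam⁻¹}

/-- `𝓡 = ℤ[1 / det A]`. -/
noncomputable def ringR {n : ℕ} (A : Matrix (Fin n) (Fin n) ℤ) : Subalgebra ℤ ℚ :=
  Algebra.adjoin ℤ {((A.det : ℚ))⁻¹}

/-! Write Y for the module generated by the entries of u. Since A u = λu and λ ≠ 0, Y is the
increasing union of the lattices λ⁻ᵏ Span_ℤ(u). As `A.charpoly` is irreducible, the u i are
ℚ-linearly independent, so sending λ⁻ᵏ u_i to the coordinate z_k,i of a solenoid point z is
consistent, and it identifies the solenoid with the dual of Y (`exists_solenoid_equiv_addDual`).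
Characters coming from Y separate points, hence exhaust the characters of the compact solenoid
(`mem_of_separatesPoints`), so every continuous endomorphism is dual to some additive f : Y → Y.

The core is that f is a multiplication. Let v be a left eigenvector of A for a root μ ≠ λ, and let
S_k = ∑ f(λ⁻ᵏ u_i) v_i. Then S_0 = μᵏ S_k, and a power of λ times S_k has a denominator bounded
independently of k. In a Galois number field take a prime P above p. The number of roots in P is
t_p, coprime to the degree n, so a transitivity argument gives g with gμ ∈ P and gλ ∉ P. Up to a
fixed denominator, g S_0 then lies in every power of P, so S_0 = 0. Thus the vector (f(u_i)) is
orthogonal to all left eigenvectors outside λ, as is u; separability makes the two proportional, and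
the same factor x works at every level k.

Finally x lies in K, because the rational span of u is a K-line, and some λᵐ x preserves the lattice
Span_ℤ(u), hence is integral. In the second part, adj(A) expresses λ⁻¹ u_i through u with
denominator det A. -/

/-! ### Separating points of a transitive action by translates -/

/-- If a finite group acts transitively on a finite set `Λ` and `S ⊆ Λ` has cardinality coprime to
that of `Λ`, then the translates of `S` separate the points of `Λ`. -/
theorem exists_smul_mem_and_smul_notMem {G Λ : Type*} [Group G] [Finite G] [Fintype Λ]
    [MulAction G Λ] [MulAction.IsPretransitive G Λ] (S : Finset Λ)
    (hS : Nat.Coprime (Fintype.card Λ) S.card) {r s : Λ} (hrs : r ≠ s) :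
    ∃ g : G, g • r ∈ S ∧ g • s ∉ S := by
  classical
  have := Fintype.ofFinite G
  let T : Λ → Finset G := fun x => Finset.univ.filter fun g => g • x ∈ S
  have hTmem : ∀ x g, g ∈ T x ↔ g • x ∈ S := fun x g => by simp [T]
  have hTmul : ∀ (x : Λ) (g h : G), g ∈ T (h • x) ↔ g * h ∈ T x := fun x g h => by
    simp [hTmem, mul_smul]
  have hTcard : ∀ x y, (T x).card = (T y).card := by
    intro x y
    obtain ⟨h, rfl⟩ := MulAction.exists_smul_eq G x y
    exact (Finset.card_equiv (s := T (h • x)) (t := T x) (Equiv.mulRight h)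
      fun g => by simp [hTmul]).symm
  -- If no g separates r from s, then T r ⊆ T s, and equal cardinalities force T r = T s.
  by_contra hcon
  push Not at hcon
  have hTrs : T s = T r := by
    refine (Finset.eq_of_subset_of_card_le (fun g hg => ?_) (hTcard s r).le).symm
    rw [hTmem] at hg ⊢
    exact hcon g hg
  have hTinj : ∀ (x y : Λ) (h : G), T (h • x) = T (h • y) ↔ T x = T y := by
    intro x y h
    simp only [Finset.ext_iff, hTmul]
    exact ⟨fun H g => by simpa using H (g * h⁻¹), fun H g => H _⟩
  -- The fibres of T are permuted transitively by G, so they share one size. It divides |Λ|, and it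
  -- divides |S| because membership in S is read off T at g = 1. Coprimality makes the fibres
  -- singletons.
  let fib : Λ → Finset Λ := fun x => Finset.univ.filter fun y => T y = T x
  have hfib : ∀ x, (fib x).card = (fib r).card := by
    intro x
    obtain ⟨h, rfl⟩ := MulAction.exists_smul_eq G r x
    exact (Finset.card_equiv (MulAction.toPerm h) fun g => by simp [fib, hTinj]).symm
  have h1 : (fib r).card ∣ Fintype.card Λ := by
    rw [← Finset.card_univ, Finset.card_eq_sum_card_image T Finset.univ]
    refine Finset.dvd_sum fun b hb => ?_
    obtain ⟨x, -, rfl⟩ := Finset.mem_image.1 hb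
    exact (hfib x).symm.dvd
  have h2 : (fib r).card ∣ S.card := by
    rw [Finset.card_eq_sum_card_image T S]
    refine Finset.dvd_sum fun b hb => ?_
    obtain ⟨x, hx, rfl⟩ := Finset.mem_image.1 hb
    have : S.filter (fun y => T y = T x) = fib x := by
      ext y
      simp only [fib, Finset.mem_filter, Finset.mem_univ, true_and, and_iff_right_iff_imp]
      intro hy
      have : (1 : G) ∈ T y := by rw [hy, hTmem]; simpa using hx
      simpa [hTmem] using this
    exact this ▸ (hfib x).symm.dvd
  have h3 : (fib r).card = 1 := Nat.dvd_one.1 (hS ▸ Nat.dvd_gcd h1 h2)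
  obtain ⟨z, hz⟩ := Finset.card_eq_one.1 h3
  have hr : r ∈ fib r := by simp [fib]
  have hs : s ∈ fib r := by simp [fib, hTrs]
  rw [hz, Finset.mem_singleton] at hr hs
  exact hrs (hr.trans hs.symm)

/-! ### Conjugate roots and primes above p -/

theorem rootMultiplicity_prod_X_sub_C {R ι : Type*} [CommRing R] [IsDomain R] [DecidableEq R]
    (s : Finset ι) (f : ι → R) (a : R) :
    (∏ i ∈ s, (Polynomial.X - Polynomial.C (f i))).rootMultiplicity a =
      (s.filter fun i => f i = a).card := by
  rw [← Polynomial.count_roots, Polynomial.roots_prod _ _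
    (Finset.prod_ne_zero_iff.2 fun i _ => Polynomial.X_sub_C_ne_zero _)]
  simp only [Polynomial.roots_X_sub_C, Multiset.bind_singleton, Multiset.count_map,
    Finset.card_def, Finset.filter_val, eq_comm]

/-- If `q` is a monic integer polynomial, with simple roots forming the orbit of `x` in the number
field `E`, the number of roots lying in a prime above `p` is the multiplicity of `0` as a root
of `q` modulo `p`. -/
theorem card_roots_mem_prime {E : Type*} [Field E] [NumberField E] (q : Polynomial ℤ)
    {ι : Type*} [Fintype ι] (ρ : ι → 𝓞 E)
    (hq : q.map (algebraMap ℤ (𝓞 E)) = ∏ i, (Polynomial.X - Polynomial.C (ρ i)))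
    (p : ℕ) [Fact p.Prime] (P : Ideal (𝓞 E)) [P.IsPrime] (hP : (p : 𝓞 E) ∈ P)
    [DecidablePred fun i => ρ i ∈ P] :
    (Finset.univ.filter fun i => ρ i ∈ P).card =
      (q.map (Int.castRingHom (ZMod p))).rootMultiplicity 0 := by
  classical
  have hc : CharP (𝓞 E ⧸ P) p := by
    refine (CharP.charP_iff_prime_eq_zero Fact.out).2 ?_
    rw [← map_natCast (Ideal.Quotient.mk P)]
    exact Ideal.Quotient.eq_zero_iff_mem.2 hP
  let φ : ZMod p →+* 𝓞 E ⧸ P := ZMod.castHom dvd_rfl _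
  -- Root multiplicity is unchanged by the embedding of 𝔽_p in the residue ring, where q splits into
  -- the reductions of the ρ i.
  rw [Polynomial.eq_rootMultiplicity_map (f := φ) φ.injective, map_zero, Polynomial.map_map,
    show φ.comp (Int.castRingHom (ZMod p)) =
      (Ideal.Quotient.mk P).comp (algebraMap ℤ (𝓞 E)) from RingHom.ext_int _ _,
    ← Polynomial.map_map, hq, Polynomial.map_prod]
  simp only [Polynomial.map_sub, Polynomial.map_X, Polynomial.map_C]
  rw [rootMultiplicity_prod_X_sub_C]
  simp only [Ideal.Quotient.eq_zero_iff_mem]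

/-- Two distinct roots of `q` in a Galois number field are separated by a conjugate of a prime
above `p`, provided that the degree of `q` is coprime to the number of roots in that prime. -/
theorem exists_galois_separating {E : Type*} [Field E] [NumberField E] [IsGalois ℚ E]
    (q : Polynomial ℤ) (hm : q.Monic) (hq : Irreducible q) (p : ℕ) [Fact p.Prime]
    (hcop : Nat.Coprime q.natDegree ((q.map (Int.castRingHom (ZMod p))).rootMultiplicity 0))
    (P : Ideal (𝓞 E)) [P.IsPrime] (hP : (p : 𝓞 E) ∈ P) {x y : 𝓞 E}
    (hx : Polynomial.aeval x q = 0) (hy : Polynomial.aeval y q = 0) (hxy : x ≠ y) :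
    ∃ g : E ≃ₐ[ℚ] E, g • x ∈ P ∧ g • y ∉ P := by
  classical
  have hqQ : Irreducible (q.map (algebraMap ℤ ℚ)) :=
    (hm.irreducible_iff_irreducible_map_fraction_map).1 hq
  have hmin : ∀ z : 𝓞 E, Polynomial.aeval z q = 0 →
      minpoly ℚ (z : E) = q.map (algebraMap ℤ ℚ) := by
    intro z hz
    refine (minpoly.eq_of_irreducible_of_monic hqQ ?_ (hm.map _)).symm
    rw [Polynomial.aeval_map_algebraMap, Polynomial.aeval_algebraMap_apply, hz, map_zero]
  have horb : ∀ z : 𝓞 E, Polynomial.aeval z q = 0 → z ∈ MulAction.orbit (E ≃ₐ[ℚ] E) x := by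
    intro z hz
    obtain ⟨g, hg⟩ := (Normal.minpoly_eq_iff_mem_orbit (F := ℚ) (E := E)).1 ((hmin z hz).trans (hmin x hx).symm)
    exact ⟨g, NumberField.RingOfIntegers.ext hg⟩
  have hfin : Finite (MulAction.orbit (E ≃ₐ[ℚ] E) x) := Set.finite_range _
  have : Fintype (MulAction.orbit (E ≃ₐ[ℚ] E) x) := Fintype.ofFinite _
  have horb' : ∀ z ∈ MulAction.orbit (E ≃ₐ[ℚ] E) x, Polynomial.aeval z q = 0 := by
    rintro _ ⟨g, rfl⟩
    have h1 : Polynomial.aeval (g (x : E)) q = 0 := by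
      rw [← Polynomial.aeval_map_algebraMap ℚ, Polynomial.aeval_algHom_apply g (x : E),
        Polynomial.aeval_map_algebraMap, Polynomial.aeval_algebraMap_apply, hx, map_zero, map_zero]
    exact (Polynomial.aeval_algebraMap_eq_zero_iff E (g • x) q).1 h1
  have hprod : q.map (algebraMap ℤ (𝓞 E)) =
      ∏ i : MulAction.orbit (E ≃ₐ[ℚ] E) x, (Polynomial.X - Polynomial.C (i : 𝓞 E)) := by
    have hinj : Function.Injective (algebraMap (𝓞 E) E) := FaithfulSMul.algebraMap_injective _ _
    refine Polynomial.map_injective _ hinj ?_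
    rw [Polynomial.map_map, ← IsScalarTower.algebraMap_eq, Polynomial.map_prod]
    simp only [Polynomial.map_sub, Polynomial.map_X, Polynomial.map_C]
    have hmap : (q.map (algebraMap ℤ ℚ)).map (algebraMap ℚ E) = q.map (algebraMap ℤ E) := by
      rw [Polynomial.map_map, ← IsScalarTower.algebraMap_eq]
    have hs : (q.map (algebraMap ℤ E)).Splits := by
      rw [← hmap, ← hmin x hx]
      exact Normal.splits inferInstance _
    have hnd : (q.map (algebraMap ℤ E)).roots.Nodup := by
      rw [← hmap]
      exact Polynomial.nodup_roots (hqQ.separable.map)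
    rw [hs.eq_prod_roots_of_monic (hm.map _)]
    have hroots : (q.map (algebraMap ℤ E)).roots =
        (Finset.univ : Finset (MulAction.orbit (E ≃ₐ[ℚ] E) x)).val.map
          fun i : MulAction.orbit (E ≃ₐ[ℚ] E) x => algebraMap (𝓞 E) E (i : 𝓞 E) := by
      refine (Multiset.Nodup.ext hnd ((Multiset.nodup_map_iff_of_injective
        (hinj.comp Subtype.val_injective)).2 Finset.univ.nodup)).2 fun a => ?_
      simp only [Polynomial.mem_roots (hm.map _).ne_zero, Polynomial.IsRoot,
        Polynomial.eval_map_algebraMap, Multiset.mem_map]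
      constructor
      · intro ha
        refine ⟨⟨⟨a, ⟨q, hm, ha⟩⟩, horb _
          ((Polynomial.aeval_algebraMap_eq_zero_iff E _ q).1 ha)⟩, by simp, rfl⟩
      · rintro ⟨i, -, rfl⟩
        exact (Polynomial.aeval_algebraMap_eq_zero_iff E (i : 𝓞 E) q).2 (horb' i i.2)
    rw [hroots, Multiset.map_map]
    rfl
  have hdeg : Fintype.card (MulAction.orbit (E ≃ₐ[ℚ] E) x) = q.natDegree := by
    rw [← hm.natDegree_map (algebraMap ℤ (𝓞 E)), hprod,
      Polynomial.natDegree_prod_of_monic _ _ fun i _ => Polynomial.monic_X_sub_C _]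
    simp
  have hcard := card_roots_mem_prime q (fun i : MulAction.orbit (E ≃ₐ[ℚ] E) x => (i : 𝓞 E))
    hprod p P hP
  obtain ⟨g, h1, h2⟩ := exists_smul_mem_and_smul_notMem (G := E ≃ₐ[ℚ] E) (r := ⟨x, horb x hx⟩)
    (s := ⟨y, horb y hy⟩) _ (hdeg ▸ hcard ▸ hcop) (by simpa using hxy)
  exact ⟨g, by simpa using h1, by simpa using h2⟩

/-- A ring carries at most one ℚ-algebra structure, which reconciles the two instances. -/
instance : IsAlgClosure ℚ QBar := by
  convert (inferInstance : @IsAlgClosure ℚ (AlgebraicClosure ℚ) _ _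
    (AlgebraicClosure.instAlgebra ℚ) _)
  exact Subsingleton.elim _ _

/-- Let `lam ≠ mu` be roots of `q`. If `lam ^ m * β` is, for all `k` and a suitable `m`, the product
of `mu ^ k` and an algebraic integer, then `β = 0`. -/
theorem eq_zero_of_forall_pow_dvd (q : Polynomial ℤ) (hm : q.Monic) (hq : Irreducible q) (p : ℕ)
    [Fact p.Prime]
    (hcop : Nat.Coprime q.natDegree ((q.map (Int.castRingHom (ZMod p))).rootMultiplicity 0))
    {lam mu β : QBar} (hlam : Polynomial.aeval lam q = 0) (hmu : Polynomial.aeval mu q = 0)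
    (hne : mu ≠ lam) (hmu0 : mu ≠ 0)
    (H : ∀ k : ℕ, ∃ (m : ℕ) (γ : QBar), IsIntegral ℤ γ ∧ lam ^ m * β = mu ^ k * γ) :
    β = 0 := by
  let E := FiniteGaloisIntermediateField.adjoin ℚ ({lam, mu, β} : Set QBar)
  have hE := FiniteGaloisIntermediateField.subset_adjoin ℚ ({lam, mu, β} : Set QBar)
  have hlE : lam ∈ E.toIntermediateField := hE (by simp)
  have hmE : mu ∈ E.toIntermediateField := hE (by simp)
  have hbE : β ∈ E.toIntermediateField := hE (by simp)
  have : NumberField E := { }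
  have : IsGalois ℚ E := by
    convert E.isGalois
    exact Subsingleton.elim _ _
  have lift : ∀ z : QBar, z ∈ E.toIntermediateField → IsIntegral ℤ z →
      ∃ w : 𝓞 E, ((w : E) : QBar) = z := by
    intro z hz hi
    exact ⟨⟨⟨z, hz⟩, (isIntegral_algebraMap_iff
      (FaithfulSMul.algebraMap_injective E QBar)).1 hi⟩, rfl⟩
  have inj : ∀ w w' : 𝓞 E, ((w : E) : QBar) = w' → w = w' := fun w w' h =>
    NumberField.RingOfIntegers.ext (Subtype.ext h)
  have root : ∀ w : 𝓞 E, Polynomial.aeval ((w : E) : QBar) q = 0 → Polynomial.aeval w q = 0 := by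
    intro w hw
    exact (Polynomial.aeval_algebraMap_eq_zero_iff E w q).1
      ((Polynomial.aeval_algebraMap_eq_zero_iff QBar (w : E) q).1 hw)
  obtain ⟨x, hx⟩ := lift mu hmE ⟨q, hm, hmu⟩
  obtain ⟨y, hy⟩ := lift lam hlE ⟨q, hm, hlam⟩
  -- One N clears the denominator of β for all k, so the argument takes place in `𝓞 E` with b = Nβ.
  obtain ⟨N, hN, hNi⟩ : ∃ N : ℤ, N ≠ 0 ∧ IsIntegral ℤ (N • β) :=
    ((IsFractionRing.isAlgebraic_iff ℤ ℚ QBar).2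
      (Algebra.IsAlgebraic.isAlgebraic β)).exists_integral_multiple
  obtain ⟨b, hb⟩ := lift (N • β) (zsmul_mem hbE N) hNi
  have hpp : (Ideal.span {(p : ℤ)}).IsMaximal :=
    Int.ideal_span_isMaximal_of_prime p
  obtain ⟨P, hPm, hPp⟩ := Ideal.exists_maximal_ideal_liesOver_of_isIntegral (S := 𝓞 E)
    (Ideal.span {(p : ℤ)})
  have hpP : (p : 𝓞 E) ∈ P := by
    have := (Ideal.mem_of_liesOver P (Ideal.span {(p : ℤ)}) (p : ℤ)).1
      (Ideal.mem_span_singleton_self _)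
    simpa using this
  obtain ⟨g, hgx, hgy⟩ := exists_galois_separating q hm hq p hcop P hpP
    (root x (hx ▸ hmu)) (root y (hy ▸ hlam)) (fun h => hne (by rw [← hx, ← hy, h]))
  have hmem : ∀ k : ℕ, g • b ∈ P ^ k := by
    intro k
    obtain ⟨m, γ, hγ, h⟩ := H k
    have hγE : γ ∈ E.toIntermediateField := by
      have : γ = lam ^ m * β / mu ^ k := by rw [h, mul_div_cancel_left₀ _ (pow_ne_zero _ hmu0)]
      rw [this]
      exact div_mem (mul_mem (pow_mem hlE _) hbE) (pow_mem hmE _)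
    obtain ⟨c, hc⟩ := lift (N • γ) (zsmul_mem hγE N) (hγ.smul N)
    have key : y ^ m * b = x ^ k * c := by
      refine inj _ _ ?_
      simp only [map_mul, map_pow, MulMemClass.coe_mul, SubmonoidClass.coe_pow, hx, hy, hb, hc]
      rw [mul_smul_comm, h, mul_smul_comm]
    have hmul : (g • y) ^ m * (g • b) ∈ P ^ k := by
      rw [← smul_pow', ← smul_mul', key, smul_mul', smul_pow']
      exact Ideal.mul_mem_right _ _ (Ideal.pow_mem_pow hgx k)
    -- Powers of P are P-primary, and g • y, the conjugate of `lam`, is outside P; the dependence of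
    -- m on k is therefore harmless.
    exact (Ideal.IsPrime.mul_mem_pow P hmul).resolve_left
      fun h => hgy (hPm.isPrime.mem_of_pow_mem _ h)
  -- Krull's intersection theorem.
  have hb0 : g • b = 0 := by
    have : g • b ∈ (⨅ k, P ^ k : Ideal (𝓞 E)) := by simpa [Ideal.mem_iInf] using hmem
    rwa [Ideal.iInf_pow_eq_bot_of_isDomain P hPm.ne_top, Ideal.mem_bot] at this
  rw [smul_eq_zero_iff_eq] at hb0
  rw [hb0] at hb
  simpa [hN] using hb.symm

/-! ### Characters of compact abelian groups -/

section Duality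

variable {S : Type*} [AddCommGroup S] [TopologicalSpace S]

/-- A character of `S`, as a complex-valued continuous function. -/
noncomputable def charMap (χ : S →ₜ+ UnitAddCircle) : C(S, ℂ) where
  toFun s := (AddCircle.toCircle (χ s) : ℂ)
  continuous_toFun := continuous_subtype_val.comp (AddCircle.continuous_toCircle.comp χ.continuous)

theorem charMap_apply (χ : S →ₜ+ UnitAddCircle) (s : S) :
    charMap χ s = (AddCircle.toCircle (χ s) : ℂ) := rfl

theorem charMap_add (χ ψ : S →ₜ+ UnitAddCircle) : charMap (χ + ψ) = charMap χ * charMap ψ := by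
  ext s
  simp [charMap_apply, AddCircle.toCircle_add]

theorem charMap_zero : charMap (0 : S →ₜ+ UnitAddCircle) = 1 := by
  ext s
  simp [charMap_apply]

theorem charMap_neg (χ : S →ₜ+ UnitAddCircle) : charMap (-χ) = star (charMap χ) := by
  ext s
  rw [ContinuousMap.star_apply, charMap_apply, charMap_apply, Complex.star_def,
    ← Circle.coe_inv_eq_conj, ← AddCircle.toCircle_neg]
  rfl

-- Translating by a point a with χ a ≠ 0 multiplies the integral by a number other than 1.
open MeasureTheory in
theorem integral_charMap_eq_zero [IsTopologicalAddGroup S] [MeasurableSpace S] [BorelSpace S]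
    (μ : Measure S) [μ.IsAddLeftInvariant] {χ : S →ₜ+ UnitAddCircle} (hχ : χ ≠ 0) :
    ∫ s, charMap χ s ∂μ = 0 := by
  obtain ⟨a, ha⟩ : ∃ a, χ a ≠ 0 := by
    by_contra! h
    exact hχ (ContinuousAddMonoidHom.ext h)
  have h1 : ∫ s, charMap χ (a + s) ∂μ = ∫ s, charMap χ s ∂μ :=
    integral_add_left_eq_self _ a
  simp only [charMap_apply, map_add, AddCircle.toCircle_add, Circle.coe_mul,
    integral_const_mul] at h1 ⊢
  have h2 : ((AddCircle.toCircle (χ a) : Circle) : ℂ) ≠ 1 := by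
    intro h
    refine ha (AddCircle.injective_toCircle one_ne_zero ?_)
    rw [AddCircle.toCircle_zero]
    exact Circle.ext h
  have h3 := sub_eq_zero.2 h1
  rw [← sub_one_mul] at h3
  exact (mul_eq_zero.1 h3).resolve_left (sub_ne_zero.2 h2)

open MeasureTheory in
/-- A group of characters of a compact abelian group that separates points contains every
character. -/
theorem mem_of_separatesPoints [IsTopologicalAddGroup S] [CompactSpace S]
    (H : AddSubgroup (S →ₜ+ UnitAddCircle))
    (hH : ∀ s : S, (∀ χ ∈ H, χ s = 0) → s = 0) (χ : S →ₜ+ UnitAddCircle) : χ ∈ H := by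
  by_contra hχ
  borelize S
  -- The characters in H are closed under products, so the algebra they generate is their linear
  -- span, and orthogonality can be checked on characters. Stone–Weierstrass makes this span dense.
  let M : Submonoid C(S, ℂ) :=
    { carrier := {f | ∃ ψ ∈ H, charMap ψ = f}
      one_mem' := ⟨0, H.zero_mem, charMap_zero⟩
      mul_mem' := by
        rintro _ _ ⟨ψ, hψ, rfl⟩ ⟨ψ', hψ', rfl⟩
        exact ⟨ψ + ψ', H.add_mem hψ hψ', charMap_add _ _⟩ }
  have hspan : ∀ f, f ∈ Algebra.adjoin ℂ (M : Set C(S, ℂ)) ↔ f ∈ Submodule.span ℂ (M : Set C(S, ℂ)) := by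
    intro f
    rw [← Subalgebra.mem_toSubmodule, Algebra.adjoin_eq_span, Submonoid.closure_eq]
  let A : StarSubalgebra ℂ C(S, ℂ) :=
    { Algebra.adjoin ℂ (M : Set C(S, ℂ)) with
      star_mem' := by
        intro f hf
        change f ∈ Algebra.adjoin ℂ (M : Set C(S, ℂ)) at hf
        change star f ∈ Algebra.adjoin ℂ (M : Set C(S, ℂ))
        rw [hspan] at hf ⊢
        induction hf using Submodule.span_induction with
        | mem f hf =>
          obtain ⟨ψ, hψ, rfl⟩ := hf
          exact Submodule.subset_span ⟨-ψ, H.neg_mem hψ, charMap_neg ψ⟩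
        | zero => simp
        | add f g _ _ hf hg => rw [star_add]; exact add_mem hf hg
        | smul c f _ hf => rw [star_smul]; exact Submodule.smul_mem _ _ hf }
  have hsep : A.SeparatesPoints := by
    intro s t hst
    have : ∃ ψ ∈ H, ψ (s - t) ≠ 0 := by
      by_contra! h
      exact hst (sub_eq_zero.1 (hH _ h))
    obtain ⟨ψ, hψ, hne⟩ := this
    refine ⟨charMap ψ, ⟨charMap ψ, Algebra.subset_adjoin ⟨ψ, hψ, rfl⟩, rfl⟩, fun h => hne ?_⟩
    rw [map_sub, sub_eq_zero]
    exact AddCircle.injective_toCircle one_ne_zero (Circle.ext h)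
  have hdense := ContinuousMap.starSubalgebra_topologicalClosure_eq_top_of_separatesPoints A hsep
  let μ : Measure S := Measure.addHaar
  have hint : ∀ f : C(S, ℂ), Integrable f μ := fun f =>
    f.continuous.integrable_of_hasCompactSupport (HasCompactSupport.of_compactSpace _)
  have hzero : ∀ f ∈ A, ∫ s, (charMap (-χ) * f) s ∂μ = 0 := by
    intro f hf
    replace hf := (hspan f).1 hf
    induction hf using Submodule.span_induction with
    | mem f hf =>
      obtain ⟨ψ, hψ, rfl⟩ := hf
      rw [← charMap_add]
      refine integral_charMap_eq_zero μ fun h => hχ ?_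
      rwa [← neg_add_eq_zero.1 h] at hψ
    | zero => simp
    | add f g _ _ hf hg =>
      rw [mul_add]
      simp only [ContinuousMap.add_apply]
      rw [integral_add (hint _) (hint _), hf, hg, add_zero]
    | smul c f _ hf =>
      rw [mul_smul_comm]
      simp only [ContinuousMap.smul_apply]
      rw [integral_smul, hf, smul_zero]
  have hmem : charMap χ ∈ A.topologicalClosure := hdense ▸ trivial
  obtain ⟨f, hf, hfA⟩ := Metric.mem_closure_iff.1 hmem 1 one_pos
  -- If χ ∉ H, then f is orthogonal to χ, so this integral is the total mass; yet f is within
  -- distance less than 1 of χ, which makes it strictly smaller.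
  have h1 : ∫ s, (charMap (-χ) * (charMap χ - f)) s ∂μ = (μ.real Set.univ : ℂ) := by
    rw [mul_sub, ← charMap_add, neg_add_cancel, charMap_zero]
    simp only [ContinuousMap.sub_apply]
    rw [integral_sub (hint _) (hint _), hzero f hf]
    simp
  have h2 : ‖∫ s, (charMap (-χ) * (charMap χ - f)) s ∂μ‖ ≤ dist (charMap χ) f * μ.real Set.univ := by
    refine norm_integral_le_of_norm_le_const (Filter.Eventually.of_forall fun s => ?_)
    rw [ContinuousMap.mul_apply, norm_mul, charMap_apply, Circle.norm_coe, one_mul, dist_eq_norm]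
    exact ContinuousMap.norm_coe_le_norm (charMap χ - f) s
  have hpos : 0 < μ.real Set.univ := by
    rw [measureReal_def, ENNReal.toReal_pos_iff]
    exact ⟨isOpen_univ.measure_pos μ ⟨0, trivial⟩, measure_lt_top _ _⟩
  rw [h1, Complex.norm_real, Real.norm_of_nonneg hpos.le] at h2
  nlinarith

end Duality

/-! ### Eigenvector bases -/

/-- A matrix over an algebraically closed field with separable characteristic polynomial has
eigenvectors, one for each eigenvalue, such that a vector orthogonal to all of them vanishes. -/
theorem exists_eigenvectors_of_separable {F : Type*} [Field F] [IsAlgClosed F] {n : ℕ}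
    (B : Matrix (Fin n) (Fin n) F) (hsep : B.charpoly.Separable) :
    ∃ v : {mu : F // B.charpoly.IsRoot mu} → Fin n → F,
      (∀ mu, B *ᵥ v mu = (mu : F) • v mu) ∧ ∀ a : Fin n → F, (∀ mu, a ⬝ᵥ v mu = 0) → a = 0 := by
  classical
  have hq0 : B.charpoly ≠ 0 := B.charpoly_monic.ne_zero
  have hmem : ∀ mu : F, mu ∈ B.charpoly.roots.toFinset ↔ B.charpoly.IsRoot mu := fun mu => by
    rw [Multiset.mem_toFinset, Polynomial.mem_roots hq0]
  have hev : ∀ mu : {mu : F // B.charpoly.IsRoot mu},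
      ∃ v, Module.End.HasEigenvector (Matrix.toLin' B) (mu : F) v := by
    intro mu
    refine Module.End.HasEigenvalue.exists_hasEigenvector ?_
    rw [Module.End.hasEigenvalue_iff_isRoot_charpoly, Matrix.charpoly_toLin']
    exact mu.2
  choose v hv using hev
  refine ⟨v, fun mu => by simpa using (hv mu).apply_eq_smul, fun a ha => ?_⟩
  have hli₀ : LinearIndependent F v := Module.End.eigenvectors_linearIndependent'
    (Matrix.toLin' B) Subtype.val Subtype.val_injective v hv
  let ι : B.charpoly.roots.toFinset → {mu : F // B.charpoly.IsRoot mu} :=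
    fun mu => ⟨mu, (hmem _).1 mu.2⟩
  have hli : LinearIndependent F (v ∘ ι) :=
    hli₀.comp ι fun x y h => Subtype.ext (Subtype.mk.inj h)
  have hcard : Fintype.card B.charpoly.roots.toFinset = Module.finrank F (Fin n → F) := by
    rw [Fintype.card_coe, Multiset.toFinset_card_of_nodup (Polynomial.nodup_roots hsep),
      ← (IsAlgClosed.splits B.charpoly).natDegree_eq_card_roots, Matrix.charpoly_natDegree_eq_dim]
    simp
  rcases isEmpty_or_nonempty B.charpoly.roots.toFinset with hemp | hne
  · rw [Fintype.card_eq_zero] at hcard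
    have : n = 0 := by simpa using hcard.symm
    subst this
    exact Subsingleton.elim _ _
  have hlin : Fintype.linearCombination F a = 0 := by
    refine (basisOfLinearIndependentOfCardEqFinrank hli hcard).ext fun mu => ?_
    rw [coe_basisOfLinearIndependentOfCardEqFinrank, Fintype.linearCombination_apply,
      LinearMap.zero_apply]
    simpa [dotProduct, mul_comm] using ha (ι mu)
  ext i
  have := LinearMap.congr_fun hlin (Pi.single i 1)
  simpa using this

/-! ### The module Y as a union of lattices -/

section Entries

variable {n : ℕ} {A : Matrix (Fin n) (Fin n) ℤ} {lam : QBar} {u : Fin n → QBar}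

/-- The integral combination of the entries of `u` with coefficients `c`. -/
noncomputable def intComb (u : Fin n → QBar) : (Fin n → ℤ) →+ QBar where
  toFun c := ∑ i, (c i : QBar) * u i
  map_zero' := by simp
  map_add' c d := by simp [add_mul, Finset.sum_add_distrib]

theorem intComb_apply (u : Fin n → QBar) (c : Fin n → ℤ) :
    intComb u c = ∑ i, (c i : QBar) * u i := rfl

theorem intComb_single (u : Fin n → QBar) (i : Fin n) : intComb u (Pi.single i 1) = u i := by
  rw [intComb_apply, Finset.sum_eq_single i] <;> simp +contextual

theorem intComb_vecMul (hA : ∀ i, ∑ j, (A i j : QBar) * u j = lam * u i) (c : Fin n → ℤ) :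
    intComb u (c ᵥ* A) = lam * intComb u c := by
  simp only [intComb_apply, Matrix.vecMul, dotProduct, Int.cast_sum, Int.cast_mul, Finset.sum_mul,
    Finset.mul_sum]
  rw [Finset.sum_comm]
  refine Finset.sum_congr rfl fun i _ => ?_
  rw [mul_left_comm, ← hA i, Finset.mul_sum]
  exact Finset.sum_congr rfl fun j _ => by ring

/-- Induction principle for Y: closure under both λ and λ⁻¹ suffices. -/
theorem entryModule_le (N : AddSubgroup QBar) (hu : ∀ i, u i ∈ N)
    (h1 : ∀ y ∈ N, lam * y ∈ N) (h2 : ∀ y ∈ N, lam⁻¹ * y ∈ N) :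
    ∀ y ∈ entryModule lam u, y ∈ N := by
  have hsmul : ∀ r ∈ Algebra.adjoin ℤ {lam, lam⁻¹}, ∀ y ∈ N, r * y ∈ N := by
    intro r hr
    induction hr using Algebra.adjoin_induction with
    | mem r hr =>
      rcases hr with rfl | rfl
      exacts [h1, h2]
    | algebraMap r =>
      intro y hy
      rw [eq_intCast, ← zsmul_eq_mul]
      exact N.zsmul_mem hy r
    | add r s _ _ hr hs => intro y hy; rw [add_mul]; exact N.add_mem (hr y hy) (hs y hy)
    | mul r s _ _ hr hs => intro y hy; rw [mul_assoc]; exact hr _ (hs y hy)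
  intro y hy
  induction hy using Submodule.span_induction with
  | mem y hy => obtain ⟨i, rfl⟩ := hy; exact hu i
  | zero => exact N.zero_mem
  | add y z _ _ hy hz => exact N.add_mem hy hz
  | smul r y _ hy => exact hsmul r r.2 y hy

theorem exists_pow_mul_eq_intComb_of_le (hA : ∀ i, ∑ j, (A i j : QBar) * u j = lam * u i)
    {y : QBar} {k m : ℕ} (hkm : k ≤ m) {c : Fin n → ℤ} (h : lam ^ k * y = intComb u c) :
    ∃ c', lam ^ m * y = intComb u c' := by
  induction m, hkm using Nat.le_induction with
  | base => exact ⟨c, h⟩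
  | succ m _ ih =>
    obtain ⟨c', hc'⟩ := ih
    exact ⟨c' ᵥ* A, by rw [intComb_vecMul hA, ← hc', pow_succ', mul_assoc]⟩

/-- Every element of the module generated by the entries of an eigenvector becomes an integral
combination of the entries after multiplication by a power of the eigenvalue. -/
theorem exists_pow_mul_eq_intComb (hA : ∀ i, ∑ j, (A i j : QBar) * u j = lam * u i)
    (hlam : lam ≠ 0) {y : QBar} (hy : y ∈ entryModule lam u) :
    ∃ (k : ℕ) (c : Fin n → ℤ), lam ^ k * y = intComb u c := by
  let N : AddSubgroup QBar :=
    { carrier := {y | ∃ (k : ℕ) (c : Fin n → ℤ), lam ^ k * y = intComb u c}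
      zero_mem' := ⟨0, 0, by simp⟩
      add_mem' := by
        rintro y z ⟨k, c, hc⟩ ⟨l, d, hd⟩
        obtain ⟨c', hc'⟩ := exists_pow_mul_eq_intComb_of_le hA (le_max_left k l) hc
        obtain ⟨d', hd'⟩ := exists_pow_mul_eq_intComb_of_le hA (le_max_right k l) hd
        exact ⟨max k l, c' + d', by rw [mul_add, hc', hd', map_add]⟩
      neg_mem' := by
        rintro y ⟨k, c, hc⟩
        exact ⟨k, -c, by rw [mul_neg, hc, map_neg]⟩ }
  refine entryModule_le (lam := lam) (u := u) N (fun i => ⟨0, Pi.single i 1, ?_⟩) ?_ ?_ y hy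
  · rw [intComb_single, pow_zero, one_mul]
  · rintro y ⟨k, c, hc⟩
    exact ⟨k, c ᵥ* A, by rw [intComb_vecMul hA, ← hc]; ring⟩
  · rintro y ⟨k, c, hc⟩
    exact ⟨k + 1, c, by rw [← hc, pow_succ]; field_simp⟩

theorem inv_pow_mul_mem_entryModule (k : ℕ) {y : QBar} (hy : y ∈ entryModule lam u) :
    lam⁻¹ ^ k * y ∈ entryModule lam u :=
  Submodule.smul_mem _ (⟨lam⁻¹ ^ k, pow_mem (Algebra.subset_adjoin (by simp)) k⟩ :
    Algebra.adjoin ℤ {lam, lam⁻¹}) hy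

theorem mem_entryModule (i : Fin n) : u i ∈ entryModule lam u :=
  Submodule.subset_span (Set.mem_range_self i)

/-- The element `lam ^ (-k) * u i` of the module generated by the entries of `u`. -/
noncomputable def entryGen (lam : QBar) (u : Fin n → QBar) (k : ℕ) (i : Fin n) :
    entryModule lam u :=
  ⟨lam⁻¹ ^ k * u i, inv_pow_mul_mem_entryModule k (mem_entryModule i)⟩

theorem coe_entryGen (k : ℕ) (i : Fin n) :
    (entryGen lam u k i : QBar) = lam⁻¹ ^ k * u i := rfl

theorem eq_sum_entryGen (hlam : lam ≠ 0) {y : entryModule lam u} {k : ℕ} {c : Fin n → ℤ}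
    (h : lam ^ k * (y : QBar) = intComb u c) : y = ∑ i, c i • entryGen lam u k i := by
  refine Subtype.ext ?_
  rw [AddSubmonoidClass.coe_finsetSum]
  have : (y : QBar) = lam⁻¹ ^ k * intComb u c := by rw [← h, inv_pow]; field_simp
  rw [this, intComb_apply, Finset.mul_sum]
  refine Finset.sum_congr rfl fun i _ => ?_
  rw [AddSubgroupClass.coe_zsmul, zsmul_eq_mul, entryGen]
  ring

/-- This is λ⁻ᵏ u = A (λ⁻ᵏ⁻¹ u), the counterpart in Y of the relation A z_{k+1} = z_k. -/
theorem entryGen_eq_sum (hA : ∀ i, ∑ j, (A i j : QBar) * u j = lam * u i) (hlam : lam ≠ 0)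
    (k : ℕ) (i : Fin n) : entryGen lam u k i = ∑ j, A i j • entryGen lam u (k + 1) j := by
  refine eq_sum_entryGen hlam (c := A i) ?_
  rw [intComb_apply, hA i, coe_entryGen, pow_succ, inv_pow]
  field_simp

theorem charpoly_map_isRoot (mu : QBar) :
    (A.map (Int.cast : ℤ → QBar)).charpoly.IsRoot mu ↔ Polynomial.aeval mu A.charpoly = 0 := by
  have : A.map (Int.cast : ℤ → QBar) = A.map (Int.castRingHom QBar) := rfl
  rw [this, Matrix.charpoly_map, Polynomial.IsRoot, Polynomial.eval_map,
    Polynomial.aeval_def, RingHom.ext_int (algebraMap ℤ QBar) (Int.castRingHom QBar)]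

theorem minpoly_eq_charpoly_map (hirr : Irreducible A.charpoly)
    (hroot : Polynomial.aeval lam A.charpoly = 0) :
    minpoly ℚ lam = A.charpoly.map (algebraMap ℤ ℚ) := by
  refine (minpoly.eq_of_irreducible_of_monic
    ((A.charpoly_monic.irreducible_iff_irreducible_map_fraction_map).1 hirr) ?_
    (A.charpoly_monic.map _)).symm
  rw [← hroot]
  simp [Polynomial.aeval_def, Polynomial.eval₂_map, RingHom.ext_int _ (algebraMap ℤ QBar)]

theorem ne_zero_of_isRoot_charpoly (hdet : A.det ≠ 0)
    (hroot : Polynomial.aeval lam A.charpoly = 0) : lam ≠ 0 := by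
  rintro rfl
  refine hdet ?_
  rw [Matrix.det_eq_sign_charpoly_coeff]
  rw [← Polynomial.coeff_zero_eq_aeval_zero'] at hroot
  simp only [eq_intCast, Int.cast_eq_zero] at hroot
  rw [hroot, mul_zero]

/-- There are eigenvectors of the transpose of `A`, one for each root of the characteristic
polynomial, such that a vector orthogonal to all of them vanishes. -/
theorem exists_transpose_eigenvectors (hirr : Irreducible A.charpoly) :
    ∃ v : {mu : QBar // Polynomial.aeval mu A.charpoly = 0} → Fin n → QBar,
      (∀ mu j, ∑ i, v mu i * (A i j : QBar) = mu * v mu j) ∧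
      ∀ a : Fin n → QBar, (∀ mu, ∑ i, a i * v mu i = 0) → a = 0 := by
  have hq : ((A.map (Int.cast : ℤ → QBar))ᵀ).charpoly = A.charpoly.map (algebraMap ℤ QBar) :=
    (Matrix.charpoly_transpose _).trans (Matrix.charpoly_map A (algebraMap ℤ QBar))
  have hsep : ((A.map (Int.cast : ℤ → QBar))ᵀ).charpoly.Separable := by
    have h1 : (A.charpoly.map (algebraMap ℤ ℚ)).Separable :=
      ((A.charpoly_monic.irreducible_iff_irreducible_map_fraction_map).1 hirr).separable
    have h2 := h1.map (f := algebraMap ℚ QBar)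
    rwa [Polynomial.map_map, RingHom.ext_int ((algebraMap ℚ QBar).comp (algebraMap ℤ ℚ))
      (algebraMap ℤ QBar), ← hq] at h2
  obtain ⟨v, hv, hspan⟩ := exists_eigenvectors_of_separable _ hsep
  have hiff : ∀ mu : QBar, ((A.map (Int.cast : ℤ → QBar))ᵀ).charpoly.IsRoot mu ↔
      Polynomial.aeval mu A.charpoly = 0 := fun mu => by
    rw [Matrix.charpoly_transpose, charpoly_map_isRoot]
  refine ⟨fun mu => v ⟨mu, (hiff _).2 mu.2⟩, fun mu j => ?_, fun a ha => hspan a fun mu => ?_⟩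
  · have := congrFun (hv ⟨mu, (hiff _).2 mu.2⟩) j
    simp only [Matrix.mulVec, dotProduct, Matrix.transpose_apply, Matrix.map_apply, Pi.smul_apply,
      smul_eq_mul] at this
    rw [← this]
    exact Finset.sum_congr rfl fun i _ => mul_comm _ _
  · exact ha ⟨mu, (hiff _).1 mu.2⟩

/-! ### Endomorphisms of Y are multiplications -/

/-- An additive f commutes with the integer relation between levels k and k + 1, and moving A across
the sum onto its left eigenvector v yields one factor μ per level. -/
theorem sum_apply_entryGen_mul_eq_pow_mul
    (hA : ∀ i, ∑ j, (A i j : QBar) * u j = lam * u i) (hlam : lam ≠ 0)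
    (f : entryModule lam u →+ entryModule lam u) {mu : QBar}
    {v : Fin n → QBar} (hv : ∀ j, ∑ i, v i * (A i j : QBar) = mu * v j) (k : ℕ) :
    ∑ i, (f (entryGen lam u 0 i) : QBar) * v i =
      mu ^ k * ∑ i, (f (entryGen lam u k i) : QBar) * v i := by
  induction k with
  | zero => simp
  | succ k ih =>
    rw [ih, pow_succ, mul_assoc]
    congr 1
    simp only [entryGen_eq_sum hA hlam k, map_sum, map_zsmul, AddSubmonoidClass.coe_finsetSum,
      AddSubgroupClass.coe_zsmul, zsmul_eq_mul, Finset.sum_mul, Finset.mul_sum]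
    rw [Finset.sum_comm]
    refine Finset.sum_congr rfl fun j _ => ?_
    rw [mul_left_comm, ← hv j, Finset.mul_sum]
    exact Finset.sum_congr rfl fun i _ => by ring

theorem exists_pow_mul_eq_intComb_family
    (hA : ∀ i, ∑ j, (A i j : QBar) * u j = lam * u i) (hlam : lam ≠ 0)
    (y : Fin n → entryModule lam u) :
    ∃ (m : ℕ) (c : Fin n → Fin n → ℤ), ∀ i, lam ^ m * (y i : QBar) = intComb u (c i) := by
  choose k c hc using fun i => exists_pow_mul_eq_intComb hA hlam (y i).2
  choose d hd using fun i => exists_pow_mul_eq_intComb_of_le hA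
    (Finset.le_sup (f := k) (Finset.mem_univ i)) (hc i)
  exact ⟨_, d, hd⟩

instance : Algebra.IsAlgebraic ℤ QBar :=
  ⟨fun x => (IsFractionRing.isAlgebraic_iff ℤ ℚ QBar).2 (Algebra.IsAlgebraic.isAlgebraic x)⟩

/-- An additive endomorphism of the module generated by the entries of `u`, paired with an
eigenvector of the transpose of `A` for an eigenvalue other than that of `u`, gives zero. -/
theorem sum_apply_entryGen_mul_eq_zero (hirr : Irreducible A.charpoly) (hdet : A.det ≠ 0)
    (p : ℕ) [Fact p.Prime] (hcop : Nat.Coprime n (zeroMultiplicity A p))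
    (hA : ∀ i, ∑ j, (A i j : QBar) * u j = lam * u i)
    (hroot : Polynomial.aeval lam A.charpoly = 0)
    (f : entryModule lam u →+ entryModule lam u)
    {mu : QBar} (hmu : Polynomial.aeval mu A.charpoly = 0) (hne : mu ≠ lam)
    {v : Fin n → QBar} (hv : ∀ j, ∑ i, v i * (A i j : QBar) = mu * v j) :
    ∑ i, (f (entryGen lam u 0 i) : QBar) * v i = 0 := by
  classical
  have hlam := ne_zero_of_isRoot_charpoly hdet hroot
  -- δ is a common denominator of all products u_j v_i; it does not depend on k.
  obtain ⟨δ, hδ, hint⟩ := Algebra.IsAlgebraic.exists_integral_multiples ℤ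
    (Finset.univ.image fun ij : Fin n × Fin n => u ij.1 * v ij.2)
  have key : δ • (∑ i, (f (entryGen lam u 0 i) : QBar) * v i) = 0 := by
    refine eq_zero_of_forall_pow_dvd A.charpoly A.charpoly_monic hirr p
      (by simpa [zeroMultiplicity] using hcop) hroot hmu hne
      (ne_zero_of_isRoot_charpoly hdet hmu) fun k => ?_
    obtain ⟨m, c, hc⟩ := exists_pow_mul_eq_intComb_family hA hlam fun i => f (entryGen lam u k i)
    refine ⟨m, ∑ i, ∑ j, (c i j : QBar) * (δ • (u j * v i)), ?_, ?_⟩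
    · refine IsIntegral.sum _ fun i _ => IsIntegral.sum _ fun j _ => IsIntegral.mul ?_ (hint _ ?_)
      · exact isIntegral_algebraMap (x := c i j)
      · exact Finset.mem_image.2 ⟨(j, i), Finset.mem_univ _, rfl⟩
    · rw [sum_apply_entryGen_mul_eq_pow_mul hA hlam f hv k]
      simp only [zsmul_eq_mul]
      have : ∀ i, lam ^ m * ((f (entryGen lam u k i) : QBar) * v i) =
          ∑ j, (c i j : QBar) * (u j * v i) := by
        intro i
        rw [← mul_assoc, hc i, intComb_apply, Finset.sum_mul]
        exact Finset.sum_congr rfl fun j _ => by ring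
      calc lam ^ m * (δ * (mu ^ k * ∑ i, (f (entryGen lam u k i) : QBar) * v i))
          = mu ^ k * (δ * ∑ i, lam ^ m * ((f (entryGen lam u k i) : QBar) * v i)) := by
            rw [← Finset.mul_sum]; ring
        _ = _ := by
          simp only [this, Finset.mul_sum]
          refine Finset.sum_congr rfl fun i _ => Finset.sum_congr rfl fun j _ => by ring
  simpa [hδ] using key

/-- Every additive endomorphism of the module generated by the entries of `u` is multiplication
by an algebraic number. -/
theorem exists_forall_apply_eq_mul (hirr : Irreducible A.charpoly) (hdet : A.det ≠ 0)
    (p : ℕ) [Fact p.Prime] (hcop : Nat.Coprime n (zeroMultiplicity A p))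
    (hA : ∀ i, ∑ j, (A i j : QBar) * u j = lam * u i) (hu : u ≠ 0)
    (hroot : Polynomial.aeval lam A.charpoly = 0)
    (f : entryModule lam u →+ entryModule lam u) :
    ∃ x : QBar, ∀ y, (f y : QBar) = x * y := by
  have hlam := ne_zero_of_isRoot_charpoly hdet hroot
  have horth : ∀ (mu : QBar) (v : Fin n → QBar),
      (∀ j, ∑ i, v i * (A i j : QBar) = mu * v j) → mu ≠ lam → ∑ i, u i * v i = 0 := by
    intro mu v hv hne
    have h : mu * ∑ i, u i * v i = lam * ∑ i, u i * v i := by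
      calc mu * ∑ i, u i * v i = ∑ j, ∑ i, u j * v i * (A i j : QBar) := by
            rw [Finset.mul_sum]
            refine Finset.sum_congr rfl fun j _ => ?_
            rw [mul_left_comm, ← hv j, Finset.mul_sum]
            exact Finset.sum_congr rfl fun i _ => by ring
        _ = lam * ∑ i, u i * v i := by
            rw [Finset.sum_comm, Finset.mul_sum]
            refine Finset.sum_congr rfl fun i _ => ?_
            rw [← mul_assoc, ← hA i, Finset.sum_mul]
            exact Finset.sum_congr rfl fun j _ => by ring
    exact (mul_eq_mul_right_iff.1 h).resolve_left hne
  obtain ⟨v, hv, hspan⟩ := exists_transpose_eigenvectors hirr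
  let w := v ⟨lam, hroot⟩
  have hw : ∀ j, ∑ i, w i * (A i j : QBar) = lam * w j := hv ⟨lam, hroot⟩
  have huw : ∑ i, u i * w i ≠ 0 := by
    intro h0
    refine hu (hspan u fun mu => ?_)
    by_cases hmu : (mu : QBar) = lam
    · obtain rfl : mu = ⟨lam, hroot⟩ := Subtype.ext hmu
      exact h0
    · exact horth mu (v mu) (hv mu) hmu
  -- Pairing f(u) = x u with the left eigenvector w for λ forces this value.
  let x : QBar := (∑ i, (f (entryGen lam u 0 i) : QBar) * w i) / ∑ i, u i * w i
  have hgen : ∀ k i, (f (entryGen lam u k i) : QBar) = x * entryGen lam u k i := by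
    intro k
    have : (fun i => lam ^ k * (f (entryGen lam u k i) : QBar) - x * u i) = 0 := by
      refine hspan _ fun mu => ?_
      have hexp : ∑ i, (lam ^ k * (f (entryGen lam u k i) : QBar) - x * u i) * v mu i =
          lam ^ k * ∑ i, (f (entryGen lam u k i) : QBar) * v mu i - x * ∑ i, u i * v mu i := by
        simp only [sub_mul, Finset.sum_sub_distrib, Finset.mul_sum, mul_assoc]
      rw [hexp]
      by_cases hmu : (mu : QBar) = lam
      · obtain rfl : mu = ⟨lam, hroot⟩ := Subtype.ext hmu
        rw [← sum_apply_entryGen_mul_eq_pow_mul hA hlam f hw k, div_mul_cancel₀ _ huw, sub_self]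
      · have h0 := sum_apply_entryGen_mul_eq_zero hirr hdet p hcop hA hroot f mu.2 hmu (hv mu)
        rw [sum_apply_entryGen_mul_eq_pow_mul hA hlam f (hv mu) k] at h0
        rw [(mul_eq_zero.1 h0).resolve_left
          (pow_ne_zero _ (ne_zero_of_isRoot_charpoly hdet mu.2)), horth mu (v mu) (hv mu) hmu,
          mul_zero, mul_zero, sub_self]
    intro i
    have hi := sub_eq_zero.1 (congrFun this i)
    rw [coe_entryGen, mul_left_comm, ← hi, inv_pow, inv_mul_cancel_left₀ (pow_ne_zero _ hlam)]
  refine ⟨x, fun y => ?_⟩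
  obtain ⟨k, c, hc⟩ := exists_pow_mul_eq_intComb hA hlam y.2
  rw [eq_sum_entryGen hlam hc]
  simp only [map_sum, map_zsmul, AddSubmonoidClass.coe_finsetSum, AddSubgroupClass.coe_zsmul, hgen,
    Finset.mul_sum, mul_smul_comm]

/-! ### Multipliers of Y, and bounds for Y -/

theorem rat_span_mul_mem (hA : ∀ i, ∑ j, (A i j : QBar) * u j = lam * u i)
    {x : QBar} (hx : x ∈ ℚ⟮lam⟯) {y : QBar} (hy : y ∈ Submodule.span ℚ (Set.range u)) :
    x * y ∈ Submodule.span ℚ (Set.range u) := by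
  have hlam : ∀ y ∈ Submodule.span ℚ (Set.range u), lam * y ∈ Submodule.span ℚ (Set.range u) := by
    intro y hy
    induction hy using Submodule.span_induction with
    | mem y hy =>
      obtain ⟨i, rfl⟩ := hy
      rw [← hA i]
      refine Submodule.sum_mem _ fun j _ => ?_
      rw [← zsmul_eq_mul]
      exact zsmul_mem (Submodule.subset_span (Set.mem_range_self j)) _
    | zero => simp
    | add y z _ _ hy hz => rw [mul_add]; exact add_mem hy hz
    | smul r y _ hy => rw [mul_smul_comm]; exact Submodule.smul_mem _ _ hy
  rw [← IntermediateField.mem_toSubalgebra,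
    IntermediateField.adjoin_simple_toSubalgebra_of_isAlgebraic
      (Algebra.IsAlgebraic.isAlgebraic lam)] at hx
  induction hx using Algebra.adjoin_induction generalizing y with
  | mem r hr => rw [Set.mem_singleton_iff.1 hr]; exact hlam y hy
  | algebraMap r => rw [← Algebra.smul_def]; exact Submodule.smul_mem _ _ hy
  | add r s _ _ hr hs => rw [add_mul]; exact add_mem (hr hy) (hs hy)
  | mul r s _ _ hr hs => rw [mul_assoc]; exact hr (hs hy)

/-- The rational span of the entries of `u` is the line over `ℚ(lam)` through any nonzero entry, and
the entries are linearly independent over `ℚ`. -/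
theorem linearIndependent_entries (hirr : Irreducible A.charpoly)
    (hA : ∀ i, ∑ j, (A i j : QBar) * u j = lam * u i)
    (hroot : Polynomial.aeval lam A.charpoly = 0) {i₀ : Fin n} (hi₀ : u i₀ ≠ 0) :
    LinearIndependent ℚ u ∧
      ∀ y ∈ Submodule.span ℚ (Set.range u), ∃ x ∈ ℚ⟮lam⟯, y = x * u i₀ := by
  let φ : ℚ⟮lam⟯ →ₗ[ℚ] QBar :=
    (LinearMap.mulRight ℚ (u i₀)).comp (IntermediateField.val ℚ⟮lam⟯).toLinearMap
  have hφ : Function.Injective φ := fun a b hab => Subtype.ext (mul_right_cancel₀ hi₀ hab)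
  have hle : LinearMap.range φ ≤ Submodule.span ℚ (Set.range u) := by
    rintro _ ⟨x, rfl⟩
    exact rat_span_mul_mem hA x.2 (Submodule.subset_span (Set.mem_range_self i₀))
  -- The line K u_{i₀} has dimension [K : ℚ] = n and lies in a span of n vectors, so the two
  -- coincide and the vectors are independent.
  have hfin : Module.finrank ℚ (LinearMap.range φ) = n := by
    rw [LinearMap.finrank_range_of_inj hφ,
      IntermediateField.adjoin.finrank (Algebra.IsAlgebraic.isAlgebraic lam).isIntegral,
      minpoly_eq_charpoly_map hirr hroot, A.charpoly_monic.natDegree_map,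
      Matrix.charpoly_natDegree_eq_dim, Fintype.card_fin]
  have hspan : (Set.range u).finrank ℚ ≤ n := by
    simpa using finrank_range_le_card (R := ℚ) u
  have : FiniteDimensional ℚ (Submodule.span ℚ (Set.range u)) :=
    FiniteDimensional.span_of_finite ℚ (Set.finite_range u)
  have heq := Submodule.eq_of_le_of_finrank_le hle (hspan.trans hfin.ge)
  refine ⟨linearIndependent_iff_card_eq_finrank_span.2 ?_, fun y hy => ?_⟩
  · rw [Set.finrank, ← heq, hfin, Fintype.card_fin]
  · rw [← heq] at hy
    obtain ⟨x, rfl⟩ := hy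
    exact ⟨x, x.2, rfl⟩

theorem entryModule_subset_rat_span (hA : ∀ i, ∑ j, (A i j : QBar) * u j = lam * u i) :
    ∀ y ∈ entryModule lam u, y ∈ Submodule.span ℚ (Set.range u) :=
  entryModule_le (Submodule.span ℚ (Set.range u)).toAddSubgroup
    (fun i => Submodule.subset_span (Set.mem_range_self i))
    (fun _ hy => rat_span_mul_mem hA (IntermediateField.mem_adjoin_simple_self ℚ lam) hy)
    (fun _ hy => rat_span_mul_mem hA
      (inv_mem (IntermediateField.mem_adjoin_simple_self ℚ lam)) hy)

/-- A multiplier of the module generated by the entries of `u` lies in `𝓞_K[1 / lam]`. -/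
theorem mem_ringOKLam_of_forall_mul_mem (hirr : Irreducible A.charpoly) (hdet : A.det ≠ 0)
    (hA : ∀ i, ∑ j, (A i j : QBar) * u j = lam * u i) (hu : u ≠ 0)
    (hroot : Polynomial.aeval lam A.charpoly = 0) {x : QBar}
    (hx : ∀ y ∈ entryModule lam u, x * y ∈ entryModule lam u) : x ∈ ringOKLam lam := by
  have hlam := ne_zero_of_isRoot_charpoly hdet hroot
  obtain ⟨i₀, hi₀⟩ := Function.ne_iff.1 hu
  rw [Pi.zero_apply] at hi₀
  have hxK : x ∈ ℚ⟮lam⟯ := by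
    obtain ⟨z, hz, h⟩ := (linearIndependent_entries hirr hA hroot hi₀).2 _
      (entryModule_subset_rat_span hA _ (hx _ (mem_entryModule i₀)))
    rwa [mul_right_cancel₀ hi₀ h]
  obtain ⟨m, c, hc⟩ := exists_pow_mul_eq_intComb_family hA hlam
    fun i => ⟨x * u i, hx _ (mem_entryModule i)⟩
  -- λᵐ x preserves a nonzero finitely generated ℤ-module.
  have hint : IsIntegral ℤ (lam ^ m * x) := by
    refine isIntegral_of_smul_mem_submodule (Submodule.span ℤ (Set.range u)) ?_
      (Submodule.fg_span (Set.finite_range u)) _ fun y hy => ?_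
    · intro h
      have : u i₀ ∈ (⊥ : Submodule ℤ QBar) := h ▸ Submodule.subset_span (Set.mem_range_self i₀)
      exact hi₀ (by simpa using this)
    · induction hy using Submodule.span_induction with
      | mem y hy =>
        obtain ⟨i, rfl⟩ := hy
        rw [smul_eq_mul, mul_assoc, hc i, intComb_apply]
        refine Submodule.sum_mem _ fun j _ => ?_
        rw [← zsmul_eq_mul]
        exact zsmul_mem (Submodule.subset_span (Set.mem_range_self j)) _
      | zero => simp
      | add y z _ _ hy hz => rw [smul_add]; exact add_mem hy hz
      | smul r y _ hy => rw [smul_comm]; exact Submodule.smul_mem _ _ hy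
  have hK : lam ^ m * x ∈ ℚ⟮lam⟯ :=
    mul_mem (pow_mem (IntermediateField.mem_adjoin_simple_self ℚ lam) m) hxK
  let z : 𝓞 ℚ⟮lam⟯ := ⟨⟨lam ^ m * x, hK⟩, (isIntegral_algebraMap_iff
      (FaithfulSMul.algebraMap_injective ℚ⟮lam⟯ QBar)).1 hint⟩
  have hz : algebraMap (𝓞 ℚ⟮lam⟯) QBar z = lam ^ m * x := rfl
  have : x = algebraMap (𝓞 ℚ⟮lam⟯) QBar z * lam⁻¹ ^ m := by
    rw [hz, inv_pow]; field_simp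
  rw [this]
  exact mul_mem (Subalgebra.algebraMap_mem _ z)
    (pow_mem (Algebra.subset_adjoin (Set.mem_singleton _)) m)

theorem entryModule_subset_ringOKLam (hroot : Polynomial.aeval lam A.charpoly = 0)
    (hu : ∀ i, u i ∈ Set.range (algebraMap (𝓞 ℚ⟮lam⟯) QBar)) :
    ∀ y ∈ entryModule lam u, y ∈ ringOKLam lam := by
  have hlam : lam ∈ ringOKLam lam := by
    let z : 𝓞 ℚ⟮lam⟯ := ⟨⟨lam, IntermediateField.mem_adjoin_simple_self ℚ lam⟩,
      (isIntegral_algebraMap_iff (FaithfulSMul.algebraMap_injective ℚ⟮lam⟯ QBar)).1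
        ⟨A.charpoly, A.charpoly_monic, hroot⟩⟩
    exact Subalgebra.algebraMap_mem (ringOKLam lam) z
  refine entryModule_le (ringOKLam lam).toSubring.toAddSubgroup (fun i => ?_)
    (fun _ hy => (ringOKLam lam).mul_mem hlam hy)
    (fun _ hy => (ringOKLam lam).mul_mem (Algebra.subset_adjoin (Set.mem_singleton _)) hy)
  obtain ⟨z, hz⟩ := hu i
  rw [← hz]
  exact Subalgebra.algebraMap_mem (ringOKLam lam) z

theorem int_span_subset_entryModule :
    ∀ y ∈ Submodule.span ℤ (Set.range u), y ∈ entryModule lam u := by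
  intro y hy
  refine (Submodule.span_le (p := (entryModule lam u).toAddSubgroup.toIntSubmodule)).2 ?_ hy
  rintro _ ⟨i, rfl⟩
  exact mem_entryModule i

/-- Row i of adj(A) A = det(A) I, evaluated at u, with one factor λ cancelled. -/
theorem det_mul_inv_mul_eq_intComb
    (hA : ∀ i, ∑ j, (A i j : QBar) * u j = lam * u i) (hlam : lam ≠ 0) (i : Fin n) :
    (A.det : QBar) * (lam⁻¹ * u i) = intComb u (A.adjugate i) := by
  have h : intComb u ((A.adjugate i) ᵥ* A) = (A.det : QBar) * u i := by
    have : (A.adjugate i) ᵥ* A = A.det • Pi.single i 1 := by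
      rw [← Matrix.mul_apply_eq_vecMul, Matrix.adjugate_mul]
      ext j
      simp [Matrix.one_apply, Pi.single_apply, eq_comm]
    rw [this, map_zsmul, intComb_single, zsmul_eq_mul]
  rw [intComb_vecMul hA] at h
  rw [mul_left_comm, ← h, inv_mul_cancel_left₀ hlam]

theorem entryModule_subset_span_ringR (hdet : A.det ≠ 0)
    (hA : ∀ i, ∑ j, (A i j : QBar) * u j = lam * u i) (hlam : lam ≠ 0) :
    ∀ y ∈ entryModule lam u, y ∈ Submodule.span (ringR A) (Set.range u) := by
  have hcomb : ∀ c, intComb u c ∈ Submodule.span (ringR A) (Set.range u) := by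
    intro c
    rw [intComb_apply]
    refine Submodule.sum_mem _ fun j _ => ?_
    rw [← zsmul_eq_mul]
    exact zsmul_mem (Submodule.subset_span (Set.mem_range_self j)) _
  have hstab : ∀ z : QBar, (∀ i, z * u i ∈ Submodule.span (ringR A) (Set.range u)) →
      ∀ y ∈ Submodule.span (ringR A) (Set.range u),
        z * y ∈ Submodule.span (ringR A) (Set.range u) := by
    intro z hz y hy
    induction hy using Submodule.span_induction with
    | mem y hy => obtain ⟨i, rfl⟩ := hy; exact hz i
    | zero => simp
    | add y w _ _ hy hw => rw [mul_add]; exact add_mem hy hw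
    | smul r y _ hy => rw [mul_smul_comm]; exact Submodule.smul_mem _ _ hy
  refine entryModule_le (Submodule.span (ringR A) (Set.range u)).toAddSubgroup
    (fun i => Submodule.subset_span (Set.mem_range_self i)) (hstab lam fun i => ?_) (hstab lam⁻¹ fun i => ?_)
  · rw [← hA i]
    exact hcomb (A i)
  · let r : ringR A := ⟨(A.det : ℚ)⁻¹, Algebra.subset_adjoin (Set.mem_singleton _)⟩
    have : lam⁻¹ * u i = r • intComb u (A.adjugate i) := by
      rw [← det_mul_inv_mul_eq_intComb hA hlam i]
      change _ = (A.det : ℚ)⁻¹ • ((A.det : QBar) * (lam⁻¹ * u i))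
      have hd : (A.det : QBar) ≠ 0 := Int.cast_ne_zero.2 hdet
      rw [Algebra.smul_def, map_inv₀, map_intCast, inv_mul_cancel_left₀ hd]
    rw [this]
    exact Submodule.smul_mem _ _ (hcomb _)

end Entries

/-! ### The solenoid as the dual of Y -/

section Solenoid

variable {n : ℕ} {A : Matrix (Fin n) (Fin n) ℤ} {lam : QBar} {u : Fin n → QBar}

instance : CompactSpace (solenoid A) := by
  refine isCompact_iff_compactSpace.1 (IsClosed.isCompact ?_)
  have hset : (solenoid A : Set (ℕ → Fin n → UnitAddCircle)) =
      ⋂ j, {z | torusEnd A (z (j + 1)) = z j} := by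
    ext z
    simp [solenoid]
  have hcont : Continuous (torusEnd A) :=
    continuous_pi fun i => continuous_finsetSum Finset.univ fun j _ =>
      (continuous_apply j).zsmul (A i j)
  rw [hset]
  exact isClosed_iInter fun j =>
    isClosed_eq (hcont.comp (continuous_apply _)) (continuous_apply _)

theorem solenoid_apply (z : solenoid A) (k : ℕ) (i : Fin n) :
    (z : ℕ → Fin n → UnitAddCircle) k i =
      ∑ j, A i j • (z : ℕ → Fin n → UnitAddCircle) (k + 1) j :=
  (congrFun (z.2 k) i).symm

/-- The character of the solenoid given by the `k`-th coordinate and an integer vector. -/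
noncomputable def coordChar (A : Matrix (Fin n) (Fin n) ℤ) (k : ℕ) (c : Fin n → ℤ) :
    solenoid A →ₜ+ UnitAddCircle where
  toFun z := ∑ i, c i • (z : ℕ → Fin n → UnitAddCircle) k i
  map_zero' := by simp
  map_add' z w := by simp [Finset.sum_add_distrib]
  continuous_toFun := continuous_finsetSum _ fun i _ =>
    ((continuous_apply i).comp ((continuous_apply k).comp continuous_subtype_val)).zsmul _

theorem coordChar_apply (k : ℕ) (c : Fin n → ℤ) (z : solenoid A) :
    coordChar A k c z = ∑ i, c i • (z : ℕ → Fin n → UnitAddCircle) k i := rfl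

theorem coordChar_vecMul (k : ℕ) (c : Fin n → ℤ) :
    coordChar A (k + 1) (c ᵥ* A) = coordChar A k c := by
  ext z
  simp only [coordChar_apply, Matrix.vecMul, dotProduct, solenoid_apply z k, Finset.smul_sum,
    Finset.sum_smul, mul_smul]
  exact Finset.sum_comm

theorem coordChar_add (k : ℕ) (c d : Fin n → ℤ) :
    coordChar A k (c + d) = coordChar A k c + coordChar A k d := by
  ext z
  simp [coordChar_apply, add_smul, Finset.sum_add_distrib]

theorem exists_coordChar_eq_of_le (hA : ∀ i, ∑ j, (A i j : QBar) * u j = lam * u i)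
    {y : QBar} {k m : ℕ} (hkm : k ≤ m) {c : Fin n → ℤ} (h : lam ^ k * y = intComb u c) :
    ∃ c', lam ^ m * y = intComb u c' ∧ coordChar A m c' = coordChar A k c := by
  induction m, hkm using Nat.le_induction with
  | base => exact ⟨c, h, rfl⟩
  | succ m _ ih =>
    obtain ⟨c', hc', hm⟩ := ih
    exact ⟨c' ᵥ* A, by rw [intComb_vecMul hA, ← hc', pow_succ', mul_assoc],
      by rw [coordChar_vecMul, hm]⟩

theorem intComb_injective (hli : LinearIndependent ℚ u) : Function.Injective (intComb u) := by
  refine (injective_iff_map_eq_zero _).2 fun c hc => ?_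
  ext i
  have := Fintype.linearIndependent_iff.1 hli (fun i => (c i : ℚ)) (by
    rw [← hc, intComb_apply]
    exact Finset.sum_congr rfl fun i _ => by rw [Algebra.smul_def, map_intCast]) i
  exact_mod_cast this

/-- The character attached to y is independent of its presentation: raise both to a common level,
where linear independence makes the coefficients equal. -/
theorem coordChar_eq (hA : ∀ i, ∑ j, (A i j : QBar) * u j = lam * u i)
    (hli : LinearIndependent ℚ u) {y : QBar} {k m : ℕ} {c d : Fin n → ℤ}
    (hc : lam ^ k * y = intComb u c) (hd : lam ^ m * y = intComb u d) :
    coordChar A k c = coordChar A m d := by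
  obtain ⟨c', h1, h2⟩ := exists_coordChar_eq_of_le hA (le_max_left k m) hc
  obtain ⟨d', h3, h4⟩ := exists_coordChar_eq_of_le hA (le_max_right k m) hd
  rw [← h2, ← h4, intComb_injective hli (h1.symm.trans h3)]

/-- The pairing between the module generated by the entries of `u` and the solenoid. -/
theorem exists_pairing (hA : ∀ i, ∑ j, (A i j : QBar) * u j = lam * u i) (hlam : lam ≠ 0)
    (hli : LinearIndependent ℚ u) :
    ∃ ev : entryModule lam u →+ (solenoid A →ₜ+ UnitAddCircle),
      ∀ (z : solenoid A) k i, ev (entryGen lam u k i) z = (z : ℕ → Fin n → UnitAddCircle) k i := by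
  choose k c hc using fun y : entryModule lam u => exists_pow_mul_eq_intComb hA hlam y.2
  have hev : ∀ (y : entryModule lam u) {m : ℕ} {d : Fin n → ℤ},
      lam ^ m * (y : QBar) = intComb u d → coordChar A (k y) (c y) = coordChar A m d :=
    fun y _ _ hd => coordChar_eq hA hli (hc y) hd
  refine ⟨AddMonoidHom.mk' (fun y => coordChar A (k y) (c y)) fun y w => ?_, fun z m i => ?_⟩
  · obtain ⟨c', h1, h2⟩ := exists_coordChar_eq_of_le hA (le_max_left (k y) (k w)) (hc y)
    obtain ⟨d', h3, h4⟩ := exists_coordChar_eq_of_le hA (le_max_right (k y) (k w)) (hc w)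
    rw [← h2, ← h4, ← coordChar_add]
    refine hev _ ?_
    rw [map_add, ← h1, ← h3, ← mul_add]
    rfl
  · change coordChar A _ _ z = _
    rw [hev (m := m) (d := Pi.single i 1), coordChar_apply, Finset.sum_eq_single i]
    · simp
    · intro j _ hj
      simp [hj]
    · simp
    · rw [intComb_single, coe_entryGen, inv_pow, mul_inv_cancel_left₀ (pow_ne_zero _ hlam)]

theorem addDual_apply_eq (hA : ∀ i, ∑ j, (A i j : QBar) * u j = lam * u i) (hlam : lam ≠ 0)
    {φ ψ : entryModule lam u →+ UnitAddCircle}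
    (h : ∀ k i, φ (entryGen lam u k i) = ψ (entryGen lam u k i)) : φ = ψ := by
  ext y
  obtain ⟨k, c, hc⟩ := exists_pow_mul_eq_intComb hA hlam y.2
  rw [eq_sum_entryGen hlam hc]
  simp only [map_sum, map_zsmul, h]

/-- The solenoid is the Pontryagin dual of the module generated by the entries of `u`. -/
theorem exists_solenoid_equiv_addDual (hA : ∀ i, ∑ j, (A i j : QBar) * u j = lam * u i)
    (hlam : lam ≠ 0) (hli : LinearIndependent ℚ u) :
    ∃ (Φ : solenoid A ≃ₜ+ AddDual (entryModule lam u))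
      (ev : entryModule lam u →+ (solenoid A →ₜ+ UnitAddCircle)), ∀ z y, Φ z y = ev y z := by
  obtain ⟨ev, hev⟩ := exists_pairing hA hlam hli
  let Φ₀ : solenoid A →+ AddDual (entryModule lam u) := AddMonoidHom.mk' (fun z =>
    { toFun := fun y => ev y z
      map_zero' := by simp
      map_add' := fun y w => by simp
      continuous_toFun := continuous_of_discreteTopology }) fun z w => by
        ext y
        exact map_add (ev y) z w
  have hΦ : ∀ z y, Φ₀ z y = ev y z := fun _ _ => rfl
  have hbij : Function.Bijective Φ₀ := by
    refine ⟨(injective_iff_map_eq_zero _).2 fun z hz => Subtype.ext ?_, fun ψ => ?_⟩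
    · ext k i
      rw [← hev, ← hΦ, hz]
      rfl
    · let z : solenoid A := ⟨fun k i => ψ (entryGen lam u k i), fun k => by
        ext i
        change _ = ψ (entryGen lam u k i)
        rw [entryGen_eq_sum hA hlam k i, map_sum]
        simp only [map_zsmul]
        rfl⟩
      refine ⟨z, ContinuousAddMonoidHom.toAddMonoidHom_injective
        (addDual_apply_eq hA hlam fun k i => ?_)⟩
      exact (hΦ _ _).trans (hev z k i)
  -- As Y is discrete, joint continuity reduces to that of each character `ev y`; the inverse is
  -- continuous because the source is compact and the target Hausdorff.
  have hcont : Continuous Φ₀ := by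
    refine ContinuousAddMonoidHom.continuous_of_continuous_uncurry _ ?_
    refine continuous_prod_of_discrete_right.2 fun y => ?_
    exact (ev y).continuous_toFun
  let e := AddEquiv.ofBijective Φ₀ hbij
  exact ⟨{ e with
    continuous_toFun := hcont
    continuous_invFun := (Continuous.homeoOfEquivCompactToT2 (f := e.toEquiv) hcont).symm.continuous },
    ev, hΦ⟩

/-! ### Dualizing endomorphisms -/

/-- Characters with values in `ℝ / ℤ` separate the points of an abelian group. -/
theorem exists_addMonoidHom_unitAddCircle_ne_zero {Y : Type*} [AddCommGroup Y] {y : Y}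
    (hy : y ≠ 0) : ∃ φ : Y →+ UnitAddCircle, φ y ≠ 0 := by
  obtain ⟨χ, hχ⟩ : ∃ χ : CharacterModule Y, χ y ≠ 0 := by
    by_contra! h
    exact hy (CharacterModule.eq_zero_of_character_apply h)
  -- `CharacterModule` takes values in ℚ/ℤ, which embeds in ℝ/ℤ.
  let ι : AddCircle (1 : ℚ) →+ UnitAddCircle :=
    QuotientAddGroup.map _ _ (Rat.castHom ℝ).toAddMonoidHom (by
      rintro _ ⟨m, rfl⟩
      exact ⟨m, by simp⟩)
  have hι : Function.Injective ι := by
    refine (injective_iff_map_eq_zero _).2 fun t ht => ?_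
    obtain ⟨q, rfl⟩ := QuotientAddGroup.mk_surjective t
    obtain ⟨m, hm⟩ := (QuotientAddGroup.eq_zero_iff ((q : ℚ) : ℝ)).1 ht
    refine (QuotientAddGroup.eq_zero_iff q).2 ⟨m, ?_⟩
    have : (m : ℝ) = q := by simpa using hm
    simpa using (by exact_mod_cast this : (m : ℚ) = q)
  exact ⟨ι.comp χ, fun h => hχ (hι (h.trans (map_zero ι).symm))⟩

/-- Every continuous endomorphism of the dual of a discrete group is dual to an endomorphism. -/
theorem exists_dual_endomorphism {S Y : Type*} [AddCommGroup S] [TopologicalSpace S]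
    [IsTopologicalAddGroup S] [CompactSpace S] [AddCommGroup Y] [TopologicalSpace Y]
    [DiscreteTopology Y] (Φ : S ≃ₜ+ AddDual Y) (ev : Y →+ (S →ₜ+ UnitAddCircle))
    (hev : ∀ z y, Φ z y = ev y z) (α : S →ₜ+ S) :
    ∃ f : Y →+ Y, ∀ s y, Φ (α s) y = Φ s (f y) := by
  have hinj : ∀ y, ev y = 0 → y = 0 := by
    intro y hy
    by_contra hne
    obtain ⟨φ, hφ⟩ := exists_addMonoidHom_unitAddCircle_ne_zero hne
    obtain ⟨s, hs⟩ := Φ.surjective ⟨φ, continuous_of_discreteTopology⟩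
    refine hφ ?_
    have := hev s y
    rw [hs, hy] at this
    exact this
  -- The range of `ev` separates points because Φ is injective, so it contains the pulled-back
  -- character.
  have hmem : ∀ y, ∃ w, ev w = (ev y).comp α := by
    intro y
    refine mem_of_separatesPoints ev.range (fun s hs => ?_) _
    refine (map_eq_zero_iff Φ Φ.injective).1 (ContinuousAddMonoidHom.ext fun w => ?_)
    rw [hev]
    exact hs _ ⟨w, rfl⟩
  choose f hf using hmem
  refine ⟨AddMonoidHom.mk' f fun y w => ?_, fun s y => ?_⟩
  · refine sub_eq_zero.1 (hinj _ ?_)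
    rw [map_sub, map_add, hf, hf, hf, map_add, sub_eq_zero]
    rfl
  · rw [hev, hev]
    exact (DFunLike.congr_fun (hf y) s).symm

end Solenoid

theorem mainTheorem8 {n : ℕ} (A : Matrix (Fin n) (Fin n) ℤ)
    (hdet : A.det ≠ 0)
    (hirr : Irreducible A.charpoly)
    (hP : (primesPrime A).Nonempty)
    (hcop : ∃ p : ℕ, p.Prime ∧ Nat.Coprime n (zeroMultiplicity A p))
    (lam : QBar) (u : Fin n → QBar)
    (hu : Module.End.HasEigenvector
      (Matrix.toLin' (A.map (Int.cast : ℤ → QBar))) lam u) :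
    (∃ Φ : solenoid A ≃ₜ+ AddDual (entryModule lam u),
      ∀ α : solenoid A →ₜ+ solenoid A,
        ∃ x ∈ ringOKLam lam, ∃ αHat : entryModule lam u →+ entryModule lam u,
          (∀ y, (αHat y : QBar) = x * (y : QBar)) ∧
          ∀ (s : solenoid A) (y : entryModule lam u), Φ (α s) y = Φ s (αHat y)) ∧
    ((∀ i, u i ∈ Set.range (algebraMap (𝓞 ℚ⟮lam⟯) QBar)) →
      (entryModule lam u : Set QBar) ⊆ (ringOKLam lam : Set QBar) ∧
      (Submodule.span ℤ (Set.range u) : Set QBar) ⊆ (entryModule lam u : Set QBar) ∧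
      (entryModule lam u : Set QBar) ⊆
        (Submodule.span (ringR A) (Set.range u) : Set QBar)) := by
  have hA : ∀ i, ∑ j, (A i j : QBar) * u j = lam * u i := by
    intro i
    simpa [Matrix.mulVec, dotProduct] using congrFun hu.apply_eq_smul i
  have hu0 : u ≠ 0 := hu.2
  have hroot : Polynomial.aeval lam A.charpoly = 0 := by
    rw [← charpoly_map_isRoot, ← Matrix.charpoly_toLin',
      ← Module.End.hasEigenvalue_iff_isRoot_charpoly]
    exact Module.End.hasEigenvalue_of_hasEigenvector hu
  have hlam := ne_zero_of_isRoot_charpoly hdet hroot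
  obtain ⟨i₀, hi₀⟩ := Function.ne_iff.1 hu0
  have hli := (linearIndependent_entries hirr hA hroot hi₀).1
  obtain ⟨p, hp, hpn⟩ := hcop
  have : Fact p.Prime := ⟨hp⟩
  constructor
  · obtain ⟨Φ, ev, hev⟩ := exists_solenoid_equiv_addDual hA hlam hli
    refine ⟨Φ, fun α => ?_⟩
    obtain ⟨f, hf⟩ := exists_dual_endomorphism Φ ev hev α
    obtain ⟨x, hx⟩ := exists_forall_apply_eq_mul hirr hdet p hpn hA hu0 hroot f
    refine ⟨x, mem_ringOKLam_of_forall_mul_mem hirr hdet hA hu0 hroot fun y hy => ?_, f, hx, hf⟩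
    rw [← hx ⟨y, hy⟩]
    exact (f ⟨y, hy⟩).2
  · intro hint
    exact ⟨entryModule_subset_ringOKLam hroot hint, int_span_subset_entryModule,
      entryModule_subset_span_ringR hdet hA hlam⟩
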